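/- All Hilbert spaces are complex. Let $H_1,H_2,K_1,K_2$ be Hilbert spaces and let $\mathcal U\subset B(K_1,K_2)$, $\mathcal V\subset B(H_1,H_2)$ be weak* closed linear subspaces. Write $[\mathcal S]$ for the linear span of a set $\mathcal S$ and $[\mathcal S]^{-w^*}$ for its weak* closure. Assume that $\mathcal U$ and $\mathcal V$ are essential, where $\mathcal X\subset B(H,K)$ is called essential if $\overline{[\mathcal X H]}=K$ and $\overline{[\mathcal X^*K]}=H$. Assume also that $\mathcal U$ and $\mathcal V$ are weak TRO equivalent: there are linear subspaces $\mathcal M_i\subset B(H_i,K_i)$ with $\mathcal M_i\mathcal M_i^*\mathcal M_i\subset\mathcal M_i$ ($i=1,2$) such that $$\mathcal U=[\mathcal M_2\mathcal V\mathcal M_1^*]^{-w^*},\qquad \mathcal V=[\mathcal M_2^*\mathcal U\mathcal M_1]^{-w^*}.$$ For a linear subspace $\mathcal X\subset B(H,K)$ and $T\in B(H,K)$ put $d(T,\mathcal X)=\inf_{X\in\mathcal X}\|T-X\|$ and $$r_{\mathcal X}(T)=\sup\{|\langle T\xi,\eta\rangle| : \|\xi\|=\|\eta\|=1,\ \langle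 X\xi,\eta\rangle=0\ \text{for all } X\in\mathcal X\},$$ where the supremum of the empty set is $0$. For norm closed $\mathcal X$ let $$k(\mathcal X)=\sup_{T\notin\mathcal X}\frac{d(T,\mathcal X)}{r_{\mathcal X}(T)}\in[0,\infty]$$ be the hyperreflexivity constant, where the quotient is $\infty$ if $r_{\mathcal X}(T)=0$ (so $k(\mathcal X)=\infty$ if $\mathcal X$ is not reflexive) and the supremum of the empty set is $0$. For an index set $I$ let $M_I^w(\mathcal X)\subset B(H^I,K^I)$ be the space of all bounded operators between the Hilbert space direct sums $H^I=\ell^2(I,H)$ and $K^I=\ell^2(I,K)$ all of whose matrix entries belong to $\mathcal X$. 1. If $I$ is infinite and its cardinality is at least the cardinality of an orthonormal basis of $H_1$ and of an orthonormal basis of $H_2$, then $$k(M_I^w(\mathcal V))\le k(M_I^w(\mathcal U)).$$ 2. If $H_1,H_2,K_1,K_2$ are separable, then $k(M_\infty^w(\mathcal V))=k(M_\infty^w(\mathcal U))$, where $\infty=\aleph_0$. -/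

import Mathlib

open scoped ENNReal InnerProductSpace

namespace OperatorSpaces

noncomputable section

section Basic

variable {H K : Type*}
  [NormedAddCommGroup H] [InnerProductSpace ℂ H]
  [NormedAddCommGroup K] [InnerProductSpace ℂ K]

/-- The weak* (ultraweak) topology of `B(H, K)`: the coarsest topology for which all functionals
`T ↦ ∑ₙ ⟨T ξₙ, ηₙ⟩` with `∑ ‖ξₙ‖² < ∞` and `∑ ‖ηₙ‖² < ∞` (that is, all trace class functionals)
are continuous. -/
@[reducible] def weakStarTopology (H K : Type*)
    [NormedAddCommGroup H] [InnerProductSpace ℂ H]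
    [NormedAddCommGroup K] [InnerProductSpace ℂ K] : TopologicalSpace (H →L[ℂ] K) :=
  ⨅ (ξ : lp (fun _ : ℕ => H) 2) (η : lp (fun _ : ℕ => K) 2),
    TopologicalSpace.induced (fun T : H →L[ℂ] K => ∑' n, ⟪η n, T (ξ n)⟫_ℂ) inferInstance

/-- A subspace of `B(H, K)` that is closed in the weak* topology. -/
def IsWeakStarClosed (U : Submodule ℂ (H →L[ℂ] K)) : Prop :=
  @IsClosed _ (weakStarTopology H K) (U : Set (H →L[ℂ] K))

/-- `[S]^{-w*}`: the weak* closure of the linear span of `S`. -/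
def weakStarSpan (S : Set (H →L[ℂ] K)) : Set (H →L[ℂ] K) :=
  @closure _ (weakStarTopology H K) (Submodule.span ℂ S : Set (H →L[ℂ] K))

/-- The map `Map(S)`, with projections identified with their ranges: it sends a subspace `P` of `H`
to the closed linear span of the vectors `T y` with `T ∈ S` and `y ∈ P`. -/
def erdosMap (S : Set (H →L[ℂ] K)) (P : Submodule ℂ H) : Submodule ℂ K :=
  (Submodule.span ℂ {z : K | ∃ T ∈ S, ∃ y ∈ P, z = T y}).topologicalClosure

/-- The distance `d(T, U)` from an operator to a subspace of `B(H, K)`. -/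
def opDist (T : H →L[ℂ] K) (U : Submodule ℂ (H →L[ℂ] K)) : ℝ≥0∞ :=
  ⨅ X ∈ U, ‖T - X‖ₑ

/-- `r_U(T)`: the supremum of `|⟨T ξ, η⟩|` over all unit vectors `ξ`, `η` with `⟨X ξ, η⟩ = 0` for
every `X ∈ U`. -/
def reflexiveSeminorm (U : Submodule ℂ (H →L[ℂ] K)) (T : H →L[ℂ] K) : ℝ≥0∞ :=
  ⨆ (ξ : H) (η : K) (_ : ‖ξ‖ = 1) (_ : ‖η‖ = 1) (_ : ∀ X ∈ U, ⟪η, X ξ⟫_ℂ = 0), ‖⟪η, T ξ⟫_ℂ‖ₑ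

/-- The hyperreflexivity constant `k(U) = sup_{T ∉ U} d(T, U) / r_U(T)`, in `[0, ∞]`. For `U` norm
closed and `T ∉ U` the distance is positive, so a quotient with `r_U(T) = 0` is `∞`; thus
`k(U) = ∞` when `U` is not reflexive. -/
def hyperreflexivityConstant (U : Submodule ℂ (H →L[ℂ] K)) : ℝ≥0∞ :=
  ⨆ (T : H →L[ℂ] K) (_ : T ∉ U), opDist T U / reflexiveSeminorm U T

/-- The matrix entry `(i, j)` of an operator between the Hilbert space direct sums `H^I`, `K^I`. -/
def matrixEntry {ι : Type*} (T : lp (fun _ : ι => H) 2 →L[ℂ] lp (fun _ : ι => K) 2) (i j : ι) :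
    H →L[ℂ] K :=
  open Classical in
  (lp.evalCLM ℂ (fun _ : ι => K) 2 i).comp
    (T.comp (lp.singleContinuousLinearMap ℂ (fun _ : ι => H) 2 j))

/-- `M_I^w(U)`: the bounded operators from `H^I` to `K^I` all of whose matrix entries are in `U`. -/
def matrixSpace (ι : Type*) (U : Submodule ℂ (H →L[ℂ] K)) :
    Submodule ℂ (lp (fun _ : ι => H) 2 →L[ℂ] lp (fun _ : ι => K) 2) where
  carrier := {T | ∀ i j, matrixEntry T i j ∈ U}
  add_mem' := by
    intro S T hS hT i j
    have h : matrixEntry (S + T) i j = matrixEntry S i j + matrixEntry T i j := by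
      ext x; simp [matrixEntry]
    rw [h]
    exact U.add_mem (hS i j) (hT i j)
  zero_mem' := by
    intro i j
    have h : matrixEntry (0 : lp (fun _ : ι => H) 2 →L[ℂ] lp (fun _ : ι => K) 2) i j = 0 := by
      ext x; simp [matrixEntry]
    rw [h]
    exact U.zero_mem
  smul_mem' := by
    intro c T hT i j
    have h : matrixEntry (c • T) i j = c • matrixEntry T i j := by
      ext x; simp [matrixEntry]
    rw [h]
    exact U.smul_mem c (hT i j)

end Basic

section Adjoints

variable {H K : Type*}
  [NormedAddCommGroup H] [InnerProductSpace ℂ H] [CompleteSpace H]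
  [NormedAddCommGroup K] [InnerProductSpace ℂ K] [CompleteSpace K]

/-- `U` is essential: `Map(U)` and `Map(U*)` send the identity projection to the identity. -/
def IsEssential (U : Submodule ℂ (H →L[ℂ] K)) : Prop :=
  erdosMap (U : Set (H →L[ℂ] K)) ⊤ = ⊤ ∧
    erdosMap {S : K →L[ℂ] H | ∃ T ∈ U, S = ContinuousLinearMap.adjoint T} ⊤ = ⊤

/-- Ternary rings of operators: subspaces `M` of `B(H, K)` with `M M* M ⊆ M`. -/
def IsTRO (M : Submodule ℂ (H →L[ℂ] K)) : Prop :=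
  ∀ A ∈ M, ∀ B ∈ M, ∀ C ∈ M, A ∘L ContinuousLinearMap.adjoint B ∘L C ∈ M

end Adjoints

section Equivalence

variable {H₁ H₂ K₁ K₂ : Type*}
  [NormedAddCommGroup H₁] [InnerProductSpace ℂ H₁] [CompleteSpace H₁]
  [NormedAddCommGroup H₂] [InnerProductSpace ℂ H₂] [CompleteSpace H₂]
  [NormedAddCommGroup K₁] [InnerProductSpace ℂ K₁] [CompleteSpace K₁]
  [NormedAddCommGroup K₂] [InnerProductSpace ℂ K₂] [CompleteSpace K₂]

/-- `U ⊆ B(K₁, K₂)` and `V ⊆ B(H₁, H₂)` are weak TRO equivalent: there are TROs `Mᵢ ⊆ B(Hᵢ, Kᵢ)`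
with `U = [M₂ V M₁*]^{-w*}` and `V = [M₂* U M₁]^{-w*}`. -/
def WeakTROEquivalent (U : Submodule ℂ (K₁ →L[ℂ] K₂)) (V : Submodule ℂ (H₁ →L[ℂ] H₂)) : Prop :=
  ∃ (M₁ : Submodule ℂ (H₁ →L[ℂ] K₁)) (M₂ : Submodule ℂ (H₂ →L[ℂ] K₂)),
    IsTRO M₁ ∧ IsTRO M₂ ∧
    (U : Set (K₁ →L[ℂ] K₂)) =
      weakStarSpan {X | ∃ B ∈ M₂, ∃ T ∈ V, ∃ A ∈ M₁,
        X = B ∘L T ∘L ContinuousLinearMap.adjoint A} ∧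
    (V : Set (H₁ →L[ℂ] H₂)) =
      weakStarSpan {X | ∃ B ∈ M₂, ∃ T ∈ U, ∃ A ∈ M₁,
        X = ContinuousLinearMap.adjoint B ∘L T ∘L A}

end Equivalence

end

end OperatorSpaces

/-! The heart of the matter is that `V` amplified is, up to a strong limit, a compression of `U`
amplified by contractions. Let `M` be a TRO that annihilates only `0`; both `M₁` and `M₂` are such
when `V` is essential. For finitely many `n_j ∈ M` put `a = ∑ n_j* n_j` and `c = (a + ε)^{-1/2}`.
The column `m_j = n_j c` has entries in the norm closure of `M` and satisfies `∑ m_j* m_j = c a c =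
1 - ε c² ≤ 1`, while `‖ε n_j c²‖ ≤ √ε`. Since the ranges of the `n*` are total, these columns are
approximately isometric (`IsTRO.exists_column`). For infinite `I` and finite `J` one has `I × J ≃
I`, so a column repeated along the diagonal becomes a contraction `A : H^I → K^I`
(`exists_columnOperator`), and `A* A → 1` strongly.

With such `A` over `M₁` and `B` over `M₂`, the map `T ↦ B T A*` sends the amplification of `V` into
that of `U`, and `X ↦ B* X A` sends it back. Hence `d(B*B T A*A, V) ≤ d(B T A*, U) ≤ k(U) r_U(B T
A*) ≤ k(U) r_V(T)`, with `U` and `V` standing for their amplifications. The left side is lower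
semicontinuous under bounded weak limits (`opDist_le_of_weak_limit`), so `d(T, V) ≤ k(U) r_V(T)`.
The reverse inequality follows by exchanging `U` and `V`. -/

open Filter Topology

namespace OperatorSpaces


/-! ### Bounded weak limits and lower semicontinuity of the distance. -/

section WeakLimits

variable {H K : Type*}
  [NormedAddCommGroup H] [InnerProductSpace ℂ H]
  [NormedAddCommGroup K] [InnerProductSpace ℂ K]

/-- Closedness under limits of norm bounded filters in the weak operator topology. -/
def IsBoundedlyWeakClosed (W : Submodule ℂ (H →L[ℂ] K)) : Prop :=
  ∀ (l : Filter (H →L[ℂ] K)) [NeBot l] (C : ℝ) (T : H →L[ℂ] K),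
    (∀ᶠ X in l, X ∈ W ∧ ‖X‖ ≤ C) →
    (∀ x y, Tendsto (fun X : H →L[ℂ] K => ⟪y, X x⟫_ℂ) l (𝓝 ⟪y, T x⟫_ℂ)) → T ∈ W

theorem summable_lp_two_sq {ι E : Type*} [NormedAddCommGroup E] (f : lp (fun _ : ι => E) 2) :
    Summable fun i => ‖f i‖ ^ 2 := by
  simpa using (lp.memℓp f).summable (by norm_num)

theorem summable_norm_mul_norm {ι E F : Type*} [NormedAddCommGroup E] [NormedAddCommGroup F]
    (f : lp (fun _ : ι => E) 2) (g : lp (fun _ : ι => F) 2) : Summable fun i => ‖f i‖ * ‖g i‖ := by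
  refine Summable.of_nonneg_of_le (fun i => by positivity) (fun i => ?_)
    ((summable_lp_two_sq f).add (summable_lp_two_sq g))
  nlinarith [sq_nonneg (‖f i‖ - ‖g i‖), sq_nonneg (‖f i‖), sq_nonneg (‖g i‖)]

/-- On bounded sets weak operator convergence implies weak* convergence: the series defining a trace
class functional is dominated by `C ∑ ‖ξ n‖ ‖η n‖`. -/
theorem IsWeakStarClosed.isBoundedlyWeakClosed {W : Submodule ℂ (H →L[ℂ] K)}
    (hW : IsWeakStarClosed W) : IsBoundedlyWeakClosed W := by
  intro l _ C T hl hT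
  have hlim : Tendsto id l (@nhds _ (weakStarTopology H K) T) := by
    rw [nhds_iInf, tendsto_iInf]
    intro ξ
    rw [nhds_iInf, tendsto_iInf]
    intro η
    rw [nhds_induced, tendsto_comap_iff]
    refine tendsto_tsum_of_dominated_convergence (𝓕 := l)
      (f := fun X : H →L[ℂ] K => fun n => ⟪η n, X (ξ n)⟫_ℂ)
      (g := fun n => ⟪η n, T (ξ n)⟫_ℂ)
      (bound := fun n => C * (‖ξ n‖ * ‖η n‖)) ((summable_norm_mul_norm ξ η).mul_left C)
      (fun n => hT _ _) ?_
    filter_upwards [hl] with X hX n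
    calc ‖⟪η n, X (ξ n)⟫_ℂ‖ ≤ ‖η n‖ * ‖X (ξ n)‖ := norm_inner_le_norm _ _
      _ ≤ ‖η n‖ * (C * ‖ξ n‖) := by gcongr; exact X.le_of_opNorm_le hX.2 _
      _ = _ := by ring
  let _ := weakStarTopology H K
  exact IsClosed.mem_of_tendsto (f := id) hW hlim (hl.mono fun X hX => hX.1)

theorem IsBoundedlyWeakClosed.isClosed {W : Submodule ℂ (H →L[ℂ] K)}
    (hW : IsBoundedlyWeakClosed W) : IsClosed (W : Set (H →L[ℂ] K)) := by
  refine isClosed_of_closure_subset fun T hT => ?_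
  have : NeBot (𝓝[(W : Set (H →L[ℂ] K))] T) := mem_closure_iff_nhdsWithin_neBot.1 hT
  -- Operators norm close to `T` have norm below `‖T‖ + 1`, which supplies the required bound.
  refine hW (𝓝[W] T) (‖T‖ + 1) T ?_ fun x y => ?_
  · refine Eventually.and self_mem_nhdsWithin (nhdsWithin_le_nhds ?_)
    have : Tendsto (fun X : H →L[ℂ] K => ‖X‖) (𝓝 T) (𝓝 ‖T‖) := continuous_norm.tendsto T
    exact (this.eventually_lt_const (lt_add_one _)).mono fun X hX => le_of_lt hX
  · have : Continuous fun X : H →L[ℂ] K => ⟪y, X x⟫_ℂ := by fun_prop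
    exact (this.tendsto T).mono_left nhdsWithin_le_nhds

/-- Evaluation of a matrix coefficient is weak* continuous. -/
theorem continuous_weakStar_inner (x : H) (y : K) :
    @Continuous _ _ (weakStarTopology H K) inferInstance
      (fun T : H →L[ℂ] K => ⟪y, T x⟫_ℂ) := by
  -- A single coefficient is the trace class functional of two sequences supported at index `0`.
  have h : (fun T : H →L[ℂ] K => ⟪y, T x⟫_ℂ) = fun T : H →L[ℂ] K =>
      ∑' n, ⟪(lp.single 2 0 y : lp (fun _ : ℕ => K) 2) n,
        T ((lp.single 2 0 x : lp (fun _ : ℕ => H) 2) n)⟫_ℂ := by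
    funext T
    rw [tsum_eq_single 0]
    · simp
    · intro n hn
      simp [Pi.single_eq_of_ne hn]
  rw [h, continuous_iff_le_induced]
  exact iInf₂_le (f := fun (ξ : lp (fun _ : ℕ => H) 2) (η : lp (fun _ : ℕ => K) 2) =>
    TopologicalSpace.induced (fun T : H →L[ℂ] K => ∑' n, ⟪η n, T (ξ n)⟫_ℂ) inferInstance) _ _

/-- A matrix coefficient that vanishes on a set vanishes on its weak* closed span. -/
theorem inner_eq_zero_of_mem_weakStarSpan {S : Set (H →L[ℂ] K)} {x : H} {y : K}
    (h : ∀ T ∈ S, ⟪y, T x⟫_ℂ = 0) {T : H →L[ℂ] K} (hT : T ∈ weakStarSpan S) :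
    ⟪y, T x⟫_ℂ = 0 := by
  let _ := weakStarTopology H K
  have hc : IsClosed {T : H →L[ℂ] K | ⟪y, T x⟫_ℂ = 0} :=
    isClosed_singleton.preimage (continuous_weakStar_inner x y)
  refine closure_minimal (fun X hX => ?_) hc hT
  induction hX using Submodule.span_induction with
  | mem X hX => exact h X hX
  | zero => simp
  | add X Y _ _ hX hY =>
    change ⟪y, X x⟫_ℂ = 0 at hX
    change ⟪y, Y x⟫_ℂ = 0 at hY
    simp [hX, hY]
  | smul c X _ hX =>
    change ⟪y, X x⟫_ℂ = 0 at hX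
    simp [hX]

theorem subset_weakStarSpan (S : Set (H →L[ℂ] K)) : S ⊆ weakStarSpan S := by
  let _ := weakStarTopology H K
  exact Submodule.subset_span.trans subset_closure

theorem norm_le_of_weak_limit {α : Type*} {l : Filter α} [NeBot l] {X : α → H →L[ℂ] K}
    {T : H →L[ℂ] K} {C : ℝ} (hC : 0 ≤ C) (hX : ∀ᶠ a in l, ‖X a‖ ≤ C)
    (hT : ∀ x y, Tendsto (fun a => ⟪y, X a x⟫_ℂ) l (𝓝 ⟪y, T x⟫_ℂ)) : ‖T‖ ≤ C := by
  refine T.opNorm_le_of_re_inner_le hC fun x y hx hy => ?_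
  have h : ‖⟪y, T x⟫_ℂ‖ ≤ C := by
    refine le_of_tendsto (hT x y).norm (hX.mono fun a ha => ?_)
    calc ‖⟪y, X a x⟫_ℂ‖ ≤ ‖y‖ * ‖X a x‖ := norm_inner_le_norm _ _
      _ ≤ C := by simpa [hy, hx] using (X a).le_of_opNorm_le ha x
  exact (Complex.re_le_norm _).trans (by rwa [norm_inner_symm])

variable [CompleteSpace K]

/-- Bounded sets of operators are relatively compact in the weak operator topology. -/
theorem exists_weak_limit {α : Type*} (l : Ultrafilter α) (X : α → H →L[ℂ] K) {C : ℝ}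
    (hX : ∀ᶠ a in l, ‖X a‖ ≤ C) :
    ∃ T : H →L[ℂ] K, ∀ x y, Tendsto (fun a => ⟪y, X a x⟫_ℂ) l (𝓝 ⟪y, T x⟫_ℂ) := by
  have key : ∀ x : H, ∃ z : K, ‖z‖ ≤ C * ‖x‖ ∧
      ∀ y, Tendsto (fun a => ⟪y, X a x⟫_ℂ) l (𝓝 ⟪y, z⟫_ℂ) := by
    intro x
    -- For fixed `x`, Riesz representation turns the vectors `X a x` into a bounded family in the
    -- dual, where Banach–Alaoglu gives a limit.
    let φ : α → WeakDual ℂ K := fun a => StrongDual.toWeakDual (InnerProductSpace.toDual ℂ K (X a x))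
    have hφ : ∀ᶠ a in l, φ a ∈ WeakDual.toStrongDual ⁻¹' Metric.closedBall 0 (C * ‖x‖) := by
      filter_upwards [hX] with a ha
      simpa [φ] using (X a).le_of_opNorm_le ha x
    obtain ⟨f, hf, hlim⟩ := (WeakDual.isCompact_closedBall (0 : StrongDual ℂ K)
      (C * ‖x‖)).ultrafilter_le_nhds (l.map φ) (le_principal_iff.2 hφ)
    refine ⟨(InnerProductSpace.toDual ℂ K).symm (WeakDual.toStrongDual f), ?_, fun y => ?_⟩
    · simpa using hf
    · have h1 : Tendsto (fun a => φ a y) l (𝓝 (f y)) :=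
        ((WeakDual.eval_continuous y).tendsto f).comp hlim
      have h2 := (Complex.continuous_conj.tendsto _).comp h1
      have h3 : ⟪y, (InnerProductSpace.toDual ℂ K).symm (WeakDual.toStrongDual f)⟫_ℂ =
          (starRingEnd ℂ) (f y) := by
        rw [← inner_conj_symm, InnerProductSpace.toDual_symm_apply]; rfl
      rw [h3]
      refine h2.congr fun a => ?_
      simp only [Function.comp_apply]
      rw [← inner_conj_symm]; rfl
  choose g hg hlim using key
  let G : H →ₗ[ℂ] K :=
    { toFun := g
      map_add' := fun x₁ x₂ => ext_inner_left ℂ fun y => by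
        refine tendsto_nhds_unique (hlim _ y) ?_
        rw [inner_add_right]
        simpa [inner_add_right] using (hlim x₁ y).add (hlim x₂ y)
      map_smul' := fun c x => ext_inner_left ℂ fun y => by
        refine tendsto_nhds_unique (hlim _ y) ?_
        rw [RingHom.id_apply, inner_smul_right]
        simpa [inner_smul_right] using (hlim x y).const_mul c }
  exact ⟨G.mkContinuous C hg, hlim⟩

/-- The distance to a boundedly weakly closed subspace is lower semicontinuous along bounded
weakly convergent families. -/
theorem opDist_le_of_weak_limit {W : Submodule ℂ (H →L[ℂ] K)} (hW : IsBoundedlyWeakClosed W)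
    {α : Type*} {l : Filter α} [NeBot l] {X : α → H →L[ℂ] K} {T : H →L[ℂ] K} {C : ℝ}
    (hX : ∀ a, ‖X a‖ ≤ C)
    (hT : ∀ x y, Tendsto (fun a => ⟪y, X a x⟫_ℂ) l (𝓝 ⟪y, T x⟫_ℂ)) {d : ℝ≥0∞}
    (hd : ∀ a, opDist (X a) W ≤ d) : opDist T W ≤ d := by
  refine le_of_forall_gt_imp_ge_of_dense fun d' hd' => ?_
  rcases eq_or_ne d' ⊤ with rfl | htop
  · exact le_top
  have hY : ∀ a, ∃ Y ∈ W, ‖X a - Y‖ ≤ d'.toReal := fun a => by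
    obtain ⟨Y, h⟩ := iInf_lt_iff.1 ((hd a).trans_lt hd')
    obtain ⟨hYW, h⟩ := iInf_lt_iff.1 h
    refine ⟨Y, hYW, ?_⟩
    rw [← toReal_enorm]
    exact ENNReal.toReal_mono htop h.le
  choose Y hYW hY using hY
  have hYb : ∀ a, ‖Y a‖ ≤ C + d'.toReal := fun a =>
    calc ‖Y a‖ = ‖X a - (X a - Y a)‖ := by rw [sub_sub_cancel]
      _ ≤ ‖X a‖ + ‖X a - Y a‖ := norm_sub_le _ _
      _ ≤ _ := add_le_add (hX a) (hY a)
  -- The near-best approximants are bounded, so they converge weakly along an ultrafilter finer than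
  -- `l`; the limit `Z` approximates `T`.
  obtain ⟨Z, hZ⟩ := exists_weak_limit (Ultrafilter.of l) Y (Eventually.of_forall hYb)
  have hZW : Z ∈ W := by
    refine hW (((Ultrafilter.of l : Filter α)).map Y) (C + d'.toReal) Z ?_ fun x y => ?_
    · exact eventually_map.2 (Eventually.of_forall fun a => ⟨hYW a, hYb a⟩)
    · exact tendsto_map'_iff.2 (hZ x y)
  have hdist : ‖T - Z‖ ≤ d'.toReal := by
    refine norm_le_of_weak_limit (l := (Ultrafilter.of l : Filter α)) (X := fun a => X a - Y a)
      ENNReal.toReal_nonneg (Eventually.of_forall hY) fun x y => ?_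
    simpa [inner_sub_right] using ((hT x y).mono_left (Ultrafilter.of_le l)).sub (hZ x y)
  refine (iInf₂_le Z hZW).trans ?_
  rw [← ofReal_norm]
  exact ENNReal.ofReal_le_of_le_toReal hdist

end WeakLimits


/-! ### Approximately isometric columns over a TRO. -/

section ApproximateUnit

variable {H K : Type*}
  [NormedAddCommGroup H] [InnerProductSpace ℂ H] [CompleteSpace H]
  [NormedAddCommGroup K] [InnerProductSpace ℂ K]

open ContinuousLinearMap (adjoint)

/-- The operators on `H` that, together with their adjoints, multiply `N` into itself from the
right. -/
def rightMultipliers (N : Submodule ℂ (H →L[ℂ] K)) : StarSubalgebra ℂ (H →L[ℂ] H) where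
  carrier := {x | ∀ n ∈ N, n ∘L x ∈ N ∧ n ∘L star x ∈ N}
  mul_mem' {x y} hx hy n hn := by
    refine ⟨(hy _ (hx n hn).1).1, ?_⟩
    rw [star_mul]
    exact (hx _ (hy n hn).2).2
  add_mem' {x y} hx hy n hn := by
    rw [star_add, ContinuousLinearMap.comp_add, ContinuousLinearMap.comp_add]
    exact ⟨N.add_mem (hx n hn).1 (hy n hn).1, N.add_mem (hx n hn).2 (hy n hn).2⟩
  algebraMap_mem' c n hn := by
    rw [← algebraMap_star_comm, Algebra.algebraMap_eq_smul_one, Algebra.algebraMap_eq_smul_one,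
      ContinuousLinearMap.comp_smul, ContinuousLinearMap.comp_smul]
    exact ⟨N.smul_mem _ hn, N.smul_mem _ hn⟩
  star_mem' {x} hx n hn := by
    rw [star_star]
    exact (hx n hn).symm

/-- Closedness lets the continuous functional calculus stay inside the multiplier algebra, so that
`n_j c` remains in the closure of `M`. -/
theorem isClosed_rightMultipliers {N : Submodule ℂ (H →L[ℂ] K)}
    (hN : IsClosed (N : Set (H →L[ℂ] K))) :
    IsClosed (rightMultipliers N : Set (H →L[ℂ] H)) := by
  have : (rightMultipliers N : Set (H →L[ℂ] H)) = ⋂ n ∈ N,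
      {x | n ∘L x ∈ (N : Set (H →L[ℂ] K))} ∩ {x | n ∘L star x ∈ (N : Set (H →L[ℂ] K))} := by
    ext x
    simp [rightMultipliers, ← SetLike.mem_coe]
  rw [this]
  refine isClosed_biInter fun n _ => ?_
  exact (hN.preimage (by fun_prop)).inter (hN.preimage (by fun_prop))

variable [CompleteSpace K]

theorem IsTRO.adjoint_comp_mem_rightMultipliers {M : Submodule ℂ (H →L[ℂ] K)} (hM : IsTRO M)
    {n : H →L[ℂ] K} (hn : n ∈ M) :
    adjoint n ∘L n ∈ rightMultipliers M.topologicalClosure := by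
  have h : ∀ k ∈ M.topologicalClosure, k ∘L (adjoint n ∘L n) ∈ M.topologicalClosure := by
    intro k hk
    exact map_mem_closure (f := fun k : H →L[ℂ] K => k ∘L (adjoint n ∘L n)) (by fun_prop) hk
      fun k hk => hM k hk n hn n hn
  intro k hk
  refine ⟨h k hk, ?_⟩
  have : star (adjoint n ∘L n) = adjoint n ∘L n := by
    rw [ContinuousLinearMap.star_eq_adjoint, ContinuousLinearMap.adjoint_comp,
      ContinuousLinearMap.adjoint_adjoint]
  rw [this]
  exact h k hk

/-- The inverse square root `c` of `a + ε`. -/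
theorem exists_inv_sqrt_add {a : H →L[ℂ] H} (ha : 0 ≤ a) {ε : ℝ} (hε : 0 < ε)
    (S : StarSubalgebra ℂ (H →L[ℂ] H)) (hS : IsClosed (S : Set (H →L[ℂ] H))) (haS : a ∈ S) :
    ∃ c ∈ S, star c = c ∧ c * a * c = 1 - ε • (c * c) := by
  have hsa : IsSelfAdjoint a := .of_nonneg ha
  let f : ℝ → ℝ := fun x => (√(x + ε))⁻¹
  have hpos : ∀ x ∈ spectrum ℝ a, 0 < x + ε := fun x hx =>
    add_pos_of_nonneg_of_pos (spectrum_nonneg_of_nonneg ha hx) hε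
  have hf : ContinuousOn f (spectrum ℝ a) :=
    ContinuousOn.inv₀ (by fun_prop) fun x hx => (Real.sqrt_pos.2 (hpos x hx)).ne'
  refine ⟨cfc f a, cfc_mem (hs := hS) f haS, (cfc_predicate f a).star_eq, ?_⟩
  rw [eq_sub_iff_add_eq]
  have h1 : cfc f a * a * cfc f a = cfc (fun x => f x * x * f x) a := by
    rw [cfc_mul (fun x => f x * x) f a (hf.mul continuousOn_id) hf,
      cfc_mul f (fun x => x) a hf continuousOn_id, cfc_id' ℝ a]
  have h2 : ε • (cfc f a * cfc f a) = cfc (fun x => ε • (f x * f x)) a := by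
    rw [cfc_smul ε (fun x => f x * f x) a (hf.mul hf), cfc_mul f f a hf hf]
  rw [h1, h2, ← cfc_add (a := a) (fun x => f x * x * f x) (fun x => ε • (f x * f x))
    ((hf.mul continuousOn_id).mul hf) ((hf.mul hf).const_smul ε), ← cfc_one ℝ a]
  refine cfc_congr fun x hx => ?_
  have hs := Real.mul_self_sqrt (hpos x hx).le
  have hne := (Real.sqrt_pos.2 (hpos x hx)).ne'
  simp only [f, smul_eq_mul, Pi.one_apply]
  field_simp
  nlinarith

/-- Contractive columns over a ternary ring of operators that almost act as an isometry. -/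
theorem IsTRO.exists_column {M : Submodule ℂ (H →L[ℂ] K)} (hM : IsTRO M) {J : Type*} [Fintype J]
    (n : J → H →L[ℂ] K) (hn : ∀ j, n j ∈ M) {ε : ℝ} (hε : 0 < ε) :
    ∃ m : J → H →L[ℂ] K, (∀ j, m j ∈ M.topologicalClosure) ∧
      (∀ x, ∑ j, ‖m j x‖ ^ 2 ≤ ‖x‖ ^ 2) ∧
      ∀ j y, ‖∑ i, adjoint (m i) (m i (adjoint (n j) y)) - adjoint (n j) y‖ ≤ √ε * ‖y‖ := by
  let a : H →L[ℂ] H := ∑ j, adjoint (n j) ∘L n j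
  have ha : 0 ≤ a := Finset.sum_nonneg fun j _ =>
    (ContinuousLinearMap.nonneg_iff_isPositive _).2 (ContinuousLinearMap.isPositive_adjoint_comp_self (n j))
  obtain ⟨c, hcS, hcs, hc⟩ := exists_inv_sqrt_add ha hε
    (rightMultipliers M.topologicalClosure)
    (isClosed_rightMultipliers M.isClosed_topologicalClosure)
    (sum_mem fun j _ => hM.adjoint_comp_mem_rightMultipliers (hn j))
  have hca : adjoint c = c := hcs
  have hcx : ∀ x, c (a (c x)) = x - (ε : ℂ) • c (c x) := fun x => by
    simpa using DFunLike.congr_fun hc x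
  -- The quadratic form of `c a c = 1 - ε c²`; both contractivity and the error estimate come from
  -- it.
  have key : ∀ x, ∑ j, ‖n j (c x)‖ ^ 2 = ‖x‖ ^ 2 - ε * ‖c x‖ ^ 2 := fun x => by
    have h1 : ⟪x, c (a (c x))⟫_ℂ = ((∑ j, ‖n j (c x)‖ ^ 2 : ℝ) : ℂ) := by
      rw [← ContinuousLinearMap.adjoint_inner_left, hca]
      simp [a, inner_sum, ContinuousLinearMap.adjoint_inner_right, inner_self_eq_norm_sq_to_K]
    have h2 : ⟪x, c (a (c x))⟫_ℂ = ((‖x‖ ^ 2 - ε * ‖c x‖ ^ 2 : ℝ) : ℂ) := by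
      rw [hcx, inner_sub_right, inner_smul_right, ← ContinuousLinearMap.adjoint_inner_left c, hca]
      simp [inner_self_eq_norm_sq_to_K]
    exact_mod_cast h1.symm.trans h2
  refine ⟨fun j => n j ∘L c, fun j => (hcS _ (M.le_topologicalClosure (hn j))).1,
    fun x => ?_, fun j y => ?_⟩
  · have := mul_nonneg hε.le (sq_nonneg ‖c x‖)
    simpa using (key x).trans_le (by linarith)
  · have hsum : ∑ i, adjoint (n i ∘L c) ((n i ∘L c) (adjoint (n j) y)) =
        c (a (c (adjoint (n j) y))) := by
      simp [a, ContinuousLinearMap.adjoint_comp, hca]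
    rw [hsum, hcx, sub_sub_cancel_left, norm_neg]
    -- The error is `-ε c² n_j* y`, so its size is governed by the adjoint `ε n_j c²`. Applying
    -- `key` at `c z` and at `z` gives `ε² ‖n_j c² z‖² ≤ ε² ‖c z‖² ≤ ε ‖z‖²`.
    have hD : ‖n j ∘L ((ε : ℂ) • (c ∘L c))‖ ≤ √ε := by
      refine ContinuousLinearMap.opNorm_le_bound _ (Real.sqrt_nonneg ε) fun z => ?_
      have h1 : ‖n j (c (c z))‖ ^ 2 ≤ ∑ i, ‖n i (c (c z))‖ ^ 2 :=
        Finset.single_le_sum (f := fun i => ‖n i (c (c z))‖ ^ 2) (fun i _ => by positivity)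
          (Finset.mem_univ j)
      have h2 := key (c z)
      have h3 : ε * ‖c z‖ ^ 2 ≤ ‖z‖ ^ 2 := by
        have : 0 ≤ ∑ i, ‖n i (c z)‖ ^ 2 := Finset.sum_nonneg fun i _ => by positivity
        linarith [key z]
      have h4 : ‖n j (c (c z))‖ ^ 2 ≤ ‖c z‖ ^ 2 := by
        nlinarith [mul_nonneg hε.le (sq_nonneg ‖c (c z)‖)]
      refine abs_le_of_sq_le_sq' ?_ (by positivity) |>.2
      calc ‖(n j ∘L ((ε : ℂ) • (c ∘L c))) z‖ ^ 2 = ε * (ε * ‖n j (c (c z))‖ ^ 2) := by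
            simp [norm_smul, abs_of_pos hε]; ring
        _ ≤ ε * (ε * ‖c z‖ ^ 2) := by gcongr
        _ ≤ ε * ‖z‖ ^ 2 := by gcongr
        _ = (√ε * ‖z‖) ^ 2 := by rw [mul_pow, Real.sq_sqrt hε.le]
    have hadj : adjoint (n j ∘L ((ε : ℂ) • (c ∘L c))) y = (ε : ℂ) • c (c (adjoint (n j) y)) := by
      refine ext_inner_left ℂ fun v => ?_
      have h1 : ∀ v w, ⟪v, c w⟫_ℂ = ⟪c v, w⟫_ℂ := fun v w => by
        rw [← ContinuousLinearMap.adjoint_inner_left, hca]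
      simp [-Complex.coe_smul, ContinuousLinearMap.adjoint_inner_right, inner_smul_right,
        inner_smul_left, h1]
    rw [← hadj]
    refine ContinuousLinearMap.le_of_opNorm_le _ ?_ y
    rwa [LinearIsometryEquiv.norm_map]

/-- Uniformly bounded operators converge strongly if they converge on a total set. -/
theorem tendsto_apply_of_total {α : Type*} {l : Filter α} {E : Type*} [NormedAddCommGroup E]
    [NormedSpace ℂ E] {X : α → E →L[ℂ] E} (hX : ∀ a, ‖X a‖ ≤ 1) {s : Set E}
    (hs : (Submodule.span ℂ s).topologicalClosure = ⊤)
    (h : ∀ x ∈ s, Tendsto (fun a => X a x) l (𝓝 x)) (x : E) :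
    Tendsto (fun a => X a x) l (𝓝 x) := by
  have hspan : ∀ x ∈ Submodule.span ℂ s, Tendsto (fun a => X a x) l (𝓝 x) := by
    intro x hx
    induction hx using Submodule.span_induction with
    | mem x hx => exact h x hx
    | zero => simpa using tendsto_const_nhds
    | add x y _ _ hx hy => simpa using hx.add hy
    | smul c x _ hx => simpa using hx.const_smul c
  rw [Metric.tendsto_nhds]
  intro δ hδ
  have hx : x ∈ closure (Submodule.span ℂ s : Set E) := by
    rw [← Submodule.topologicalClosure_coe, hs]; trivial
  obtain ⟨y, hy, hxy⟩ := Metric.mem_closure_iff.1 hx (δ / 3) (by positivity)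
  filter_upwards [Metric.tendsto_nhds.1 (hspan y hy) (δ / 3) (by positivity)] with a ha
  have h1 : dist (X a x) (X a y) ≤ dist x y := by
    rw [dist_eq_norm, dist_eq_norm, ← map_sub]
    simpa using (X a).le_of_opNorm_le (hX a) (x - y)
  have h2 := dist_triangle4 (X a x) (X a y) y x
  rw [dist_comm y x] at h2
  linarith

end ApproximateUnit


/-! ### Coordinates of amplified spaces and operators built from columns. -/

section Columns

open ContinuousLinearMap (adjoint)

/-- The inclusion of the coordinate `i` into `H^I`. -/
noncomputable def coordIncl (H : Type*) [NormedAddCommGroup H] [InnerProductSpace ℂ H]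
    {ι : Type*} (i : ι) : H →L[ℂ] lp (fun _ : ι => H) 2 :=
  open Classical in lp.singleContinuousLinearMap ℂ (fun _ : ι => H) 2 i

/-- The projection of `H^I` onto the coordinate `i`. -/
noncomputable def coordProj (H : Type*) [NormedAddCommGroup H] [InnerProductSpace ℂ H]
    {ι : Type*} (i : ι) : lp (fun _ : ι => H) 2 →L[ℂ] H :=
  lp.evalCLM ℂ (fun _ : ι => H) 2 i

variable {H K : Type*} {ι : Type*}
  [NormedAddCommGroup H] [InnerProductSpace ℂ H]
  [NormedAddCommGroup K] [InnerProductSpace ℂ K]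

@[simp] theorem coordProj_apply (i : ι) (x : lp (fun _ : ι => H) 2) : coordProj H i x = x i := rfl

theorem matrixEntry_eq (T : lp (fun _ : ι => H) 2 →L[ℂ] lp (fun _ : ι => K) 2) (i j : ι) :
    matrixEntry T i j = coordProj K i ∘L T ∘L coordIncl H j := rfl

theorem coordIncl_apply [DecidableEq ι] (i k : ι) (x : H) :
    coordIncl H i x k = if k = i then x else 0 := by
  simp only [coordIncl, lp.singleContinuousLinearMap_apply, lp.coeFn_single, Pi.single_apply]
  congr

theorem norm_coordIncl_apply (i : ι) (x : H) : ‖coordIncl H i x‖ = ‖x‖ := by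
  classical
  exact lp.norm_single (E := fun _ : ι => H) (p := 2) (by norm_num) i x

theorem inner_coordIncl_left (i : ι) (x : H) (f : lp (fun _ : ι => H) 2) :
    ⟪coordIncl H i x, f⟫_ℂ = ⟪x, f i⟫_ℂ := by
  classical
  exact lp.inner_single_left (𝕜 := ℂ) (G := fun _ : ι => H) i x f

theorem adjoint_coordIncl [CompleteSpace H] (i : ι) : adjoint (coordIncl H i) = coordProj H i := by
  ext f
  refine ext_inner_left ℂ fun x => ?_
  rw [ContinuousLinearMap.adjoint_inner_right, inner_coordIncl_left, coordProj_apply]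

theorem adjoint_coordProj [CompleteSpace H] (i : ι) : adjoint (coordProj H i) = coordIncl H i := by
  rw [← adjoint_coordIncl, ContinuousLinearMap.adjoint_adjoint]

theorem inner_matrixEntry (T : lp (fun _ : ι => H) 2 →L[ℂ] lp (fun _ : ι => K) 2) (i j : ι)
    (x : H) (y : K) : ⟪y, matrixEntry T i j x⟫_ℂ = ⟪coordIncl K i y, T (coordIncl H j x)⟫_ℂ := by
  rw [inner_coordIncl_left]; rfl

theorem norm_matrixEntry_le (T : lp (fun _ : ι => H) 2 →L[ℂ] lp (fun _ : ι => K) 2) (i j : ι) :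
    ‖matrixEntry T i j‖ ≤ ‖T‖ := by
  refine ContinuousLinearMap.opNorm_le_bound _ (norm_nonneg T) fun x => ?_
  calc ‖matrixEntry T i j x‖ ≤ ‖T (coordIncl H j x)‖ := lp.norm_apply_le_norm (by norm_num) _ i
    _ ≤ ‖T‖ * ‖coordIncl H j x‖ := T.le_opNorm _
    _ = ‖T‖ * ‖x‖ := by rw [norm_coordIncl_apply]

/-- Taking a matrix entry is contractive and weakly continuous, so closedness is inherited
entrywise. -/
theorem IsBoundedlyWeakClosed.matrixSpace {W : Submodule ℂ (H →L[ℂ] K)}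
    (hW : IsBoundedlyWeakClosed W) (ι : Type*) :
    IsBoundedlyWeakClosed (matrixSpace ι W) := by
  intro l _ C T hl hT i j
  refine hW (l.map fun X => matrixEntry X i j) C _ ?_ fun x y => ?_
  · rw [eventually_map]
    filter_upwards [hl] with X hX
    exact ⟨hX.1 i j, (norm_matrixEntry_le X i j).trans hX.2⟩
  · rw [tendsto_map'_iff, inner_matrixEntry]
    refine (hT (coordIncl H j x) (coordIncl K i y)).congr fun X => ?_
    rw [Function.comp_apply, inner_matrixEntry]

/-- The operators `H^I → K^I` whose columns are finitely supported with entries in `N`, and whose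
rows have at most one nonzero entry. -/
def IsColumnOver (N : Submodule ℂ (H →L[ℂ] K))
    (A : lp (fun _ : ι => H) 2 →L[ℂ] lp (fun _ : ι => K) 2) : Prop :=
  (∀ k, ∃ i, ∃ m ∈ N, coordProj K k ∘L A = m ∘L coordProj H i) ∧
    ∀ i, ∃ (s : Finset ι) (m : ι → H →L[ℂ] K), (∀ k, m k ∈ N) ∧
      A ∘L coordIncl H i = ∑ k ∈ s, coordIncl K k ∘L m k

theorem norm_sq_eq_tsum {E : Type*} [NormedAddCommGroup E] (f : lp (fun _ : ι => E) 2) : ‖f‖ ^ 2 = ∑' i, ‖f i‖ ^ 2 := by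
  simpa using lp.norm_rpow_eq_tsum (p := 2) (by norm_num) f

/-- A finite contractive column over `N` induces a contraction `H^I → K^I`. -/
theorem exists_columnOperator {N : Submodule ℂ (H →L[ℂ] K)} {J : Type*} [Fintype J]
    (e : ι × J ≃ ι) (m : J → H →L[ℂ] K) (hmN : ∀ j, m j ∈ N)
    (hm : ∀ x, ∑ j, ‖m j x‖ ^ 2 ≤ ‖x‖ ^ 2) :
    ∃ A : lp (fun _ : ι => H) 2 →L[ℂ] lp (fun _ : ι => K) 2, ‖A‖ ≤ 1 ∧ IsColumnOver N A ∧
      (∀ i j, coordProj K (e (i, j)) ∘L A = m j ∘L coordProj H i) ∧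
      ∀ i, A ∘L coordIncl H i = ∑ j, coordIncl K (e (i, j)) ∘L m j := by
  classical
  have hsum : ∀ f : lp (fun _ : ι => H) 2, HasSum
      (fun k => ‖m (e.symm k).2 (f (e.symm k).1)‖ ^ 2) (∑' i, ∑ j, ‖m j (f i)‖ ^ 2) := by
    intro f
    have h1 : Summable fun i => ∑ j, ‖m j (f i)‖ ^ 2 :=
      (summable_lp_two_sq f).of_nonneg_of_le (fun i => by positivity) fun i => hm _
    have h2 : Summable fun p : ι × J => ‖m p.2 (f p.1)‖ ^ 2 := by
      refine (summable_prod_of_nonneg fun p => by positivity).2 ⟨fun i => ?_, ?_⟩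
      · exact (hasSum_fintype _).summable
      · simpa using h1
    have h3 : HasSum (fun p : ι × J => ‖m p.2 (f p.1)‖ ^ 2) (∑' i, ∑ j, ‖m j (f i)‖ ^ 2) := by
      rw [show (∑' i, ∑ j, ‖m j (f i)‖ ^ 2) = ∑' p : ι × J, ‖m p.2 (f p.1)‖ ^ 2 by
        rw [h2.tsum_prod]; simp]
      exact h2.hasSum
    exact (e.symm.hasSum_iff (f := fun p : ι × J => ‖m p.2 (f p.1)‖ ^ 2)).2 h3
  have hmem : ∀ f : lp (fun _ : ι => H) 2,
      Memℓp (fun k => m (e.symm k).2 (f (e.symm k).1)) 2 := fun f =>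
    memℓp_gen (by simpa using (hsum f).summable)
  -- Coordinate `e (i, j)` of the image of `f` is `m j (f i)`: the column is repeated along the
  -- diagonal, its `i`-th copy filling the block `{e (i, j) | j}`.
  let A₀ : lp (fun _ : ι => H) 2 →ₗ[ℂ] lp (fun _ : ι => K) 2 :=
    { toFun := fun f => ⟨fun k => m (e.symm k).2 (f (e.symm k).1), hmem f⟩
      map_add' := fun f g => by ext k; simp; rfl
      map_smul' := fun c f => by ext k; simp }
  have hA₀ : ∀ f, ‖A₀ f‖ ≤ 1 * ‖f‖ := fun f => by
    rw [one_mul]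
    refine abs_le_of_sq_le_sq' ?_ (norm_nonneg _) |>.2
    rw [norm_sq_eq_tsum, norm_sq_eq_tsum]
    refine (hsum f).tsum_eq.trans_le ?_
    refine Summable.tsum_le_tsum (fun i => hm _) ?_ (summable_lp_two_sq f)
    exact (summable_lp_two_sq f).of_nonneg_of_le (fun i => by positivity) fun i => hm _
  let A := A₀.mkContinuous 1 hA₀
  have hA : ∀ f k, A f k = m (e.symm k).2 (f (e.symm k).1) := fun f k => rfl
  have hrow : ∀ i j, coordProj K (e (i, j)) ∘L A = m j ∘L coordProj H i := fun i j => by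
    ext f; simp [hA]
  have hcol : ∀ i, A ∘L coordIncl H i = ∑ j, coordIncl K (e (i, j)) ∘L m j := fun i => by
    ext x k
    obtain ⟨⟨i', j⟩, rfl⟩ := e.surjective k
    change A (coordIncl H i x) (e (i', j)) =
      coordProj K (e (i', j)) ((∑ j, coordIncl K (e (i, j)) ∘L m j) x)
    rw [hA, sum_apply, map_sum]
    by_cases h : i' = i <;> simp [coordIncl_apply, h]
  refine ⟨A, A₀.mkContinuous_norm_le zero_le_one hA₀, ⟨fun k => ?_, fun i => ?_⟩, hrow, hcol⟩
  · obtain ⟨⟨i, j⟩, rfl⟩ := e.surjective k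
    exact ⟨i, m j, hmN j, hrow i j⟩
  · refine ⟨Finset.univ.map ⟨fun j => e (i, j), fun j j' h => by simpa using h⟩,
      fun k => m (e.symm k).2, fun k => hmN _, ?_⟩
    rw [hcol, Finset.sum_map]
    refine Finset.sum_congr rfl fun j _ => ?_
    change _ = coordIncl K (e (i, j)) ∘L m (e.symm (e (i, j))).2
    rw [e.symm_apply_apply]

end Columns


/-! ### Column operators with `A* A` tending strongly to the identity. -/

section TernaryColumns

open ContinuousLinearMap (adjoint)

variable {H K : Type*} {ι : Type*}
  [NormedAddCommGroup H] [InnerProductSpace ℂ H] [CompleteSpace H]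
  [NormedAddCommGroup K] [InnerProductSpace ℂ K] [CompleteSpace K]

/-- If only `0` is annihilated by `M`, then the vectors `m* y`, placed in any coordinate, are
total in `H^I`. -/
theorem topologicalClosure_span_coordIncl_adjoint {M : Submodule ℂ (H →L[ℂ] K)}
    (hM : ∀ x, (∀ m ∈ M, m x = 0) → x = 0) (ι : Type*) :
    (Submodule.span ℂ {z : lp (fun _ : ι => H) 2 |
      ∃ i, ∃ m ∈ M, ∃ y, z = coordIncl H i (adjoint m y)}).topologicalClosure = ⊤ := by
  rw [Submodule.topologicalClosure_eq_top_iff, Submodule.eq_bot_iff]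
  intro f hf
  ext i
  -- Orthogonality to all vectors `m* y` in coordinate `i` says that `M` annihilates `f i`.
  refine hM _ fun m hm => ext_inner_left ℂ fun y => ?_
  rw [← ContinuousLinearMap.adjoint_inner_left, inner_zero_right, ← inner_coordIncl_left]
  exact (Submodule.mem_orthogonal _ f).1 hf _ (Submodule.subset_span ⟨i, m, hm, y, rfl⟩)

/-- An infinite cardinal absorbs a nonzero finite factor; this makes room for all copies of a finite
column. -/
theorem nonempty_prod_equiv_of_infinite (ι J : Type*) [Infinite ι] [Finite J] [Nonempty J] :
    Nonempty (ι × J ≃ ι) := by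
  obtain ⟨n, ⟨g⟩⟩ := Finite.exists_equiv_fin J
  have hn : n ≠ 0 := by
    rintro rfl
    exact (g (Classical.arbitrary J)).elim0
  have h : Cardinal.mk (ι × Fin n) = Cardinal.mk ι := by
    rw [Cardinal.mk_prod, Cardinal.lift_uzero, Cardinal.mk_fin, Cardinal.lift_natCast]
    exact Cardinal.mul_eq_left (Cardinal.aleph0_le_mk ι)
      (Cardinal.natCast_lt_aleph0.le.trans (Cardinal.aleph0_le_mk ι)) (by exact_mod_cast hn)
  obtain ⟨e⟩ := Cardinal.eq.1 h
  exact ⟨(Equiv.prodCongr (Equiv.refl ι) g).trans e⟩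

theorem IsTRO.exists_columnOperator {M : Submodule ℂ (H →L[ℂ] K)} (hM : IsTRO M) [Infinite ι]
    (F : Finset M) {ε : ℝ} (hε : 0 < ε) :
    ∃ A : lp (fun _ : ι => H) 2 →L[ℂ] lp (fun _ : ι => K) 2, ‖A‖ ≤ 1 ∧
      IsColumnOver M.topologicalClosure A ∧ ∀ n ∈ F, ∀ i y,
        ‖adjoint A (A (coordIncl H i (adjoint (n : H →L[ℂ] K) y))) -
          coordIncl H i (adjoint (n : H →L[ℂ] K) y)‖ ≤ √ε * ‖y‖ := by
  obtain ⟨m, hmM, hm, happrox⟩ := hM.exists_column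
    -- The extra zero entry keeps the index type nonempty when `F` is empty.
    (fun j : Option F => j.elim 0 fun n => (n : H →L[ℂ] K))
    (by rintro (_ | n); exacts [M.zero_mem, n.1.2]) hε
  obtain ⟨e⟩ := nonempty_prod_equiv_of_infinite ι (Option F)
  obtain ⟨A, hA, hAM, hrow, hcol⟩ := OperatorSpaces.exists_columnOperator e m hmM hm
  refine ⟨A, hA, hAM, fun n hn i y => ?_⟩
  have hadj : ∀ j x, adjoint A (coordIncl K (e (i, j)) x) = coordIncl H i (adjoint (m j) x) :=
    fun j x => by
      have h := congrArg adjoint (hrow i j)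
      rw [ContinuousLinearMap.adjoint_comp, ContinuousLinearMap.adjoint_comp, adjoint_coordProj,
        adjoint_coordProj] at h
      exact DFunLike.congr_fun h x
  have hAA : ∀ x, adjoint A (A (coordIncl H i x)) =
      coordIncl H i (∑ j, adjoint (m j) (m j x)) := fun x => by
    have h : A (coordIncl H i x) = ∑ j, coordIncl K (e (i, j)) (m j x) := by
      simpa using DFunLike.congr_fun (hcol i) x
    rw [h, map_sum, map_sum]
    exact Finset.sum_congr rfl fun j _ => hadj j _
  rw [hAA, ← map_sub, norm_coordIncl_apply]
  exact happrox (some ⟨n, hn⟩) y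

/-- For a ternary ring of operators `M` that only annihilates `0`, there are contractive columns
`A : H^I → K^I` over the closure of `M` such that `A* A` converges strongly to the identity. -/
theorem IsTRO.exists_tendsto_columnOperator {M : Submodule ℂ (H →L[ℂ] K)} (hM : IsTRO M)
    (hM₀ : ∀ x, (∀ m ∈ M, m x = 0) → x = 0) (ι : Type*) [Infinite ι] :
    ∃ A : Finset M × ℕ → lp (fun _ : ι => H) 2 →L[ℂ] lp (fun _ : ι => K) 2,
      (∀ a, ‖A a‖ ≤ 1) ∧ (∀ a, IsColumnOver M.topologicalClosure (A a)) ∧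
      ∀ x, Tendsto (fun a => adjoint (A a) (A a x)) atTop (𝓝 x) := by
  -- The net is directed by larger finite subsets of `M` and by `ε = 1 / (k + 1)`.
  choose A hA hAM happrox using fun a : Finset M × ℕ =>
    hM.exists_columnOperator (ι := ι) a.1 (ε := 1 / ((a.2 : ℝ) + 1)) (by positivity)
  refine ⟨A, hA, hAM, tendsto_apply_of_total (X := fun a => adjoint (A a) ∘L A a) (fun a => ?_)
    (topologicalClosure_span_coordIncl_adjoint hM₀ ι) ?_⟩
  · refine (ContinuousLinearMap.opNorm_comp_le _ _).trans ?_
    rw [LinearIsometryEquiv.norm_map]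
    exact mul_le_one₀ (hA a) (norm_nonneg _) (hA a)
  · rintro _ ⟨i, m, hm, y, rfl⟩
    rw [tendsto_iff_norm_sub_tendsto_zero]
    have hlim : Tendsto (fun a : Finset M × ℕ => √(1 / ((a.2 : ℝ) + 1)) * ‖y‖) atTop (𝓝 0) := by
      have h1 : Tendsto (fun k : ℕ => √(1 / ((k : ℝ) + 1))) atTop (𝓝 0) := by
        simpa [Function.comp_def] using
          (Real.continuous_sqrt.tendsto 0).comp tendsto_one_div_add_atTop_nhds_zero_nat
      have h2 : Tendsto (Prod.snd : Finset M × ℕ → ℕ) atTop atTop := by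
        rw [← prod_atTop_atTop_eq]; exact tendsto_snd
      simpa using (h1.comp h2).mul_const ‖y‖
    refine squeeze_zero' (Eventually.of_forall fun a => norm_nonneg _) ?_ hlim
    filter_upwards [eventually_ge_atTop (({⟨m, hm⟩} : Finset M), 0)] with a ha
    exact happrox a ⟨m, hm⟩ (ha.1 (Finset.mem_singleton_self _)) i y

end TernaryColumns

/-! ### Passing between the amplifications of `U` and `V`. -/

section Compression

open ContinuousLinearMap (adjoint)

variable {H₁ H₂ K₁ K₂ : Type*} {ι : Type*}
  [NormedAddCommGroup H₁] [InnerProductSpace ℂ H₁]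
  [NormedAddCommGroup H₂] [InnerProductSpace ℂ H₂]
  [NormedAddCommGroup K₁] [InnerProductSpace ℂ K₁]
  [NormedAddCommGroup K₂] [InnerProductSpace ℂ K₂]
  {U : Submodule ℂ (K₁ →L[ℂ] K₂)} {V : Submodule ℂ (H₁ →L[ℂ] H₂)}
  {N₁ : Submodule ℂ (H₁ →L[ℂ] K₁)} {N₂ : Submodule ℂ (H₂ →L[ℂ] K₂)}
  {A : lp (fun _ : ι => H₁) 2 →L[ℂ] lp (fun _ : ι => K₁) 2}
  {B : lp (fun _ : ι => H₂) 2 →L[ℂ] lp (fun _ : ι => K₂) 2}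

/-- As each row of `A` and `B` has at most one nonzero entry, every entry of `B T A*` is a single
product `b T_{ii'} a*`. -/
theorem IsColumnOver.comp_comp_adjoint_mem [CompleteSpace H₁] [CompleteSpace K₁]
    (hA : IsColumnOver N₁ A) (hB : IsColumnOver N₂ B)
    (hVU : ∀ b ∈ N₂, ∀ T ∈ V, ∀ a ∈ N₁, b ∘L T ∘L adjoint a ∈ U)
    {T : lp (fun _ : ι => H₁) 2 →L[ℂ] lp (fun _ : ι => H₂) 2} (hT : T ∈ matrixSpace ι V) :
    B ∘L T ∘L adjoint A ∈ matrixSpace ι U := by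
  intro k k'
  obtain ⟨i, b, hb, hbB⟩ := hB.1 k
  obtain ⟨i', a, ha, haA⟩ := hA.1 k'
  have haA' : adjoint A ∘L coordIncl K₁ k' = coordIncl H₁ i' ∘L adjoint a := by
    rw [← adjoint_coordProj, ← ContinuousLinearMap.adjoint_comp, haA,
      ContinuousLinearMap.adjoint_comp, adjoint_coordProj]
  have : matrixEntry (B ∘L T ∘L adjoint A) k k' = b ∘L matrixEntry T i i' ∘L adjoint a := by
    calc matrixEntry (B ∘L T ∘L adjoint A) k k'
        = (coordProj K₂ k ∘L B) ∘L T ∘L (adjoint A ∘L coordIncl K₁ k') := rfl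
      _ = (b ∘L coordProj H₂ i) ∘L T ∘L (coordIncl H₁ i' ∘L adjoint a) := by rw [hbB, haA']
      _ = _ := rfl
  rw [this]
  exact hVU b hb _ (hT i i') a ha

/-- Here finite support of the columns matters: every entry of `B* X A` is a finite sum of products
`b* X_{kk'} a`, so no limit is needed. -/
theorem IsColumnOver.adjoint_comp_comp_mem [CompleteSpace H₂] [CompleteSpace K₂]
    (hA : IsColumnOver N₁ A) (hB : IsColumnOver N₂ B)
    (hUV : ∀ b ∈ N₂, ∀ X ∈ U, ∀ a ∈ N₁, adjoint b ∘L X ∘L a ∈ V)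
    {X : lp (fun _ : ι => K₁) 2 →L[ℂ] lp (fun _ : ι => K₂) 2} (hX : X ∈ matrixSpace ι U) :
    adjoint B ∘L X ∘L A ∈ matrixSpace ι V := by
  intro i i'
  obtain ⟨s, b, hb, hbB⟩ := hB.2 i
  obtain ⟨s', a, ha, haA⟩ := hA.2 i'
  have hbB' : coordProj H₂ i ∘L adjoint B = ∑ k ∈ s, adjoint (b k) ∘L coordProj K₂ k := by
    rw [← adjoint_coordIncl, ← ContinuousLinearMap.adjoint_comp, hbB, map_sum]
    simp [ContinuousLinearMap.adjoint_comp, adjoint_coordIncl]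
  have : matrixEntry (adjoint B ∘L X ∘L A) i i' =
      ∑ k ∈ s, ∑ k' ∈ s', adjoint (b k) ∘L matrixEntry X k k' ∘L a k' := by
    calc matrixEntry (adjoint B ∘L X ∘L A) i i'
        = (coordProj H₂ i ∘L adjoint B) ∘L X ∘L (A ∘L coordIncl H₁ i') := rfl
      _ = _ := by
        rw [hbB', haA]
        ext x
        simp only [ContinuousLinearMap.comp_apply, sum_apply, map_sum, matrixEntry_eq]
        exact Finset.sum_comm
  rw [this]
  exact sum_mem fun k _ => sum_mem fun k' _ => hUV _ (hb k) _ (hX k k') _ (ha k')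

/-- The distance to `V` does not increase when passing from `U` to `V` by a compression. -/
theorem opDist_compression_le {E₁ E₂ F₁ F₂ : Type*}
    [NormedAddCommGroup E₁] [InnerProductSpace ℂ E₁]
    [NormedAddCommGroup E₂] [InnerProductSpace ℂ E₂]
    [NormedAddCommGroup F₁] [InnerProductSpace ℂ F₁]
    [NormedAddCommGroup F₂] [InnerProductSpace ℂ F₂]
    {U : Submodule ℂ (F₁ →L[ℂ] F₂)} {V : Submodule ℂ (E₁ →L[ℂ] E₂)}
    {A : E₁ →L[ℂ] F₁} {B : F₂ →L[ℂ] E₂} (hA : ‖A‖ ≤ 1) (hB : ‖B‖ ≤ 1)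
    (hUV : ∀ X ∈ U, B ∘L X ∘L A ∈ V) (S : F₁ →L[ℂ] F₂) :
    opDist (B ∘L S ∘L A) V ≤ opDist S U := by
  refine le_iInf₂ fun X hX => (iInf₂_le _ (hUV X hX)).trans ?_
  rw [← ofReal_norm, ← ofReal_norm]
  refine ENNReal.ofReal_le_ofReal ?_
  have : B ∘L S ∘L A - B ∘L X ∘L A = B ∘L (S - X) ∘L A := by ext; simp
  rw [this]
  calc ‖B ∘L (S - X) ∘L A‖ ≤ ‖B‖ * ‖(S - X) ∘L A‖ := ContinuousLinearMap.opNorm_comp_le _ _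
    _ ≤ ‖B‖ * (‖S - X‖ * ‖A‖) := by gcongr; exact ContinuousLinearMap.opNorm_comp_le _ _
    _ ≤ 1 * (‖S - X‖ * 1) := by gcongr
    _ = ‖S - X‖ := by ring

end Compression


/-! ### Comparison of hyperreflexivity constants. -/

section Comparison

open ContinuousLinearMap (adjoint)

variable {E₁ E₂ F₁ F₂ : Type*}
  [NormedAddCommGroup E₁] [InnerProductSpace ℂ E₁]
  [NormedAddCommGroup E₂] [InnerProductSpace ℂ E₂]
  [NormedAddCommGroup F₁] [InnerProductSpace ℂ F₁]
  [NormedAddCommGroup F₂] [InnerProductSpace ℂ F₂]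

/-- Normalising nonzero vectors of norm at most `1` only enlarges the coefficient and preserves the
annihilation condition. -/
theorem enorm_inner_le_reflexiveSeminorm {V : Submodule ℂ (E₁ →L[ℂ] E₂)} (T : E₁ →L[ℂ] E₂)
    {x : E₁} {y : E₂} (hx : ‖x‖ ≤ 1) (hy : ‖y‖ ≤ 1) (hxy : ∀ X ∈ V, ⟪y, X x⟫_ℂ = 0) :
    ‖⟪y, T x⟫_ℂ‖ₑ ≤ reflexiveSeminorm V T := by
  rcases eq_or_ne x 0 with rfl | hx0
  · simp
  rcases eq_or_ne y 0 with rfl | hy0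
  · simp
  have hnx : ‖x‖ ≠ 0 := norm_ne_zero_iff.2 hx0
  have hny : ‖y‖ ≠ 0 := norm_ne_zero_iff.2 hy0
  let x' : E₁ := ((‖x‖⁻¹ : ℝ) : ℂ) • x
  let y' : E₂ := ((‖y‖⁻¹ : ℝ) : ℂ) • y
  have hin : ∀ X : E₁ →L[ℂ] E₂, ⟪y', X x'⟫_ℂ = ((‖y‖⁻¹ * ‖x‖⁻¹ : ℝ) : ℂ) * ⟪y, X x⟫_ℂ := fun X => by
    simp only [x', y', map_smul, inner_smul_left, inner_smul_right, Complex.conj_ofReal]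
    push_cast
    ring
  have hle : ‖⟪y, T x⟫_ℂ‖ ≤ ‖⟪y', T x'⟫_ℂ‖ := by
    rw [hin, norm_mul, Complex.norm_real, Real.norm_of_nonneg (by positivity)]
    refine le_mul_of_one_le_left (norm_nonneg _) ?_
    exact one_le_mul_of_one_le_of_one_le
      ((one_le_inv₀ (by positivity)).2 hy) ((one_le_inv₀ (by positivity)).2 hx)
  calc ‖⟪y, T x⟫_ℂ‖ₑ ≤ ‖⟪y', T x'⟫_ℂ‖ₑ := by
        rw [← ofReal_norm, ← ofReal_norm]; exact ENNReal.ofReal_le_ofReal hle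
    _ ≤ reflexiveSeminorm V T := by
      refine le_iSup₂_of_le x' y' (le_iSup₂_of_le ?_ ?_ (le_iSup_of_le (fun X hX => ?_) le_rfl))
      · simp only [x', norm_smul, Complex.norm_real, norm_inv, norm_norm]
        exact inv_mul_cancel₀ hnx
      · simp only [y', norm_smul, Complex.norm_real, norm_inv, norm_norm]
        exact inv_mul_cancel₀ hny
      · rw [hin, hxy X hX, mul_zero]

theorem reflexiveSeminorm_le_enorm (V : Submodule ℂ (E₁ →L[ℂ] E₂)) (T : E₁ →L[ℂ] E₂) :
    reflexiveSeminorm V T ≤ ‖T‖ₑ := by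
  refine iSup₂_le fun x y => iSup₂_le fun hx hy => iSup_le fun _ => ?_
  rw [← ofReal_norm, ← ofReal_norm]
  refine ENNReal.ofReal_le_ofReal ?_
  calc ‖⟪y, T x⟫_ℂ‖ ≤ ‖y‖ * ‖T x‖ := norm_inner_le_norm _ _
    _ ≤ ‖y‖ * (‖T‖ * ‖x‖) := by gcongr; exact T.le_opNorm x
    _ = ‖T‖ := by rw [hx, hy]; ring

/-- Finiteness of the constant is essential: in `ℝ≥0∞` the product `⊤ * 0` is `0`, which would not
bound the distance. -/
theorem opDist_le_mul_reflexiveSeminorm {U : Submodule ℂ (E₁ →L[ℂ] E₂)}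
    (hU : hyperreflexivityConstant U ≠ ⊤) (S : E₁ →L[ℂ] E₂) :
    opDist S U ≤ hyperreflexivityConstant U * reflexiveSeminorm U S := by
  by_cases hS : S ∈ U
  · have h0 : opDist S U ≤ 0 := (iInf₂_le S hS).trans (by rw [← ofReal_norm]; simp)
    exact h0.trans zero_le
  · refine (ENNReal.div_le_iff_le_mul (Or.inr hU) (Or.inl ?_)).1
      (le_iSup₂_of_le (f := fun T (_ : T ∉ U) => opDist T U / reflexiveSeminorm U T) S hS le_rfl)
    exact ((reflexiveSeminorm_le_enorm U S).trans_lt enorm_lt_top).ne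

variable [CompleteSpace E₁] [CompleteSpace E₂] [CompleteSpace F₁] [CompleteSpace F₂]

/-- A pair `(ξ, η)` annihilating `U` is carried to the pair `(A* ξ, B* η)`, which annihilates `V`
and has norms at most `1`. -/
theorem reflexiveSeminorm_comp_comp_adjoint_le
    {U : Submodule ℂ (F₁ →L[ℂ] F₂)} {V : Submodule ℂ (E₁ →L[ℂ] E₂)}
    {A : E₁ →L[ℂ] F₁} {B : E₂ →L[ℂ] F₂} (hA : ‖A‖ ≤ 1) (hB : ‖B‖ ≤ 1)
    (hVU : ∀ X ∈ V, B ∘L X ∘L adjoint A ∈ U) (T : E₁ →L[ℂ] E₂) :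
    reflexiveSeminorm U (B ∘L T ∘L adjoint A) ≤ reflexiveSeminorm V T := by
  refine iSup₂_le fun ξ η => iSup₂_le fun hξ hη => iSup_le fun h => ?_
  have hin : ∀ X : E₁ →L[ℂ] E₂, ⟪η, (B ∘L X ∘L adjoint A) ξ⟫_ℂ =
      ⟪adjoint B η, X (adjoint A ξ)⟫_ℂ := fun X =>
    (ContinuousLinearMap.adjoint_inner_left B _ _).symm
  rw [hin]
  refine enorm_inner_le_reflexiveSeminorm T ?_ ?_ fun X hX => ?_
  · simpa [hξ] using (adjoint A).le_of_opNorm_le ((LinearIsometryEquiv.norm_map _ _).trans_le hA) ξ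
  · simpa [hη] using (adjoint B).le_of_opNorm_le ((LinearIsometryEquiv.norm_map _ _).trans_le hB) η
  · rw [← hin]
    exact h _ (hVU X hX)

/-- If `V` is approximately a compression of `U` by contractions that map `V` into `U`, then its
hyperreflexivity constant is at most the one of `U`. -/
theorem hyperreflexivityConstant_le_of_approx_compression
    {U : Submodule ℂ (F₁ →L[ℂ] F₂)} {V : Submodule ℂ (E₁ →L[ℂ] E₂)}
    (hV : IsBoundedlyWeakClosed V) {α β : Type*} {l : Filter α} {l' : Filter β} [NeBot l] [NeBot l']
    {A : α → E₁ →L[ℂ] F₁} {B : β → E₂ →L[ℂ] F₂} (hA : ∀ a, ‖A a‖ ≤ 1) (hB : ∀ b, ‖B b‖ ≤ 1)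
    (hAlim : ∀ x, Tendsto (fun a => adjoint (A a) (A a x)) l (𝓝 x))
    (hBlim : ∀ x, Tendsto (fun b => adjoint (B b) (B b x)) l' (𝓝 x))
    (hVU : ∀ a b, ∀ X ∈ V, B b ∘L X ∘L adjoint (A a) ∈ U)
    (hUV : ∀ a b, ∀ X ∈ U, adjoint (B b) ∘L X ∘L A a ∈ V) :
    hyperreflexivityConstant V ≤ hyperreflexivityConstant U := by
  rcases eq_or_ne (hyperreflexivityConstant U) ⊤ with hk | hk
  · rw [hk]; exact le_top
  have hB' : ∀ b, ‖adjoint (B b)‖ ≤ 1 := fun b => (LinearIsometryEquiv.norm_map _ _).trans_le (hB b)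
  have hA' : ∀ a, ‖adjoint (A a)‖ ≤ 1 := fun a => (LinearIsometryEquiv.norm_map _ _).trans_le (hA a)
  refine iSup₂_le fun T _ => ENNReal.div_le_of_le_mul ?_
  refine opDist_le_of_weak_limit hV (l := l ×ˢ l') (C := ‖T‖)
    (X := fun p => adjoint (B p.2) ∘L (B p.2 ∘L T ∘L adjoint (A p.1)) ∘L A p.1)
    (fun p => ?_) (fun x y => ?_) fun p => ?_
  · refine ContinuousLinearMap.opNorm_le_bound _ (norm_nonneg T) fun x => ?_
    calc ‖adjoint (B p.2) (B p.2 (T (adjoint (A p.1) (A p.1 x))))‖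
        ≤ 1 * ‖B p.2 (T (adjoint (A p.1) (A p.1 x)))‖ :=
          (adjoint (B p.2)).le_of_opNorm_le (hB' _) _
      _ ≤ 1 * (1 * ‖T (adjoint (A p.1) (A p.1 x))‖) := by
          gcongr; exact (B p.2).le_of_opNorm_le (hB _) _
      _ ≤ 1 * (1 * (‖T‖ * (1 * (1 * ‖x‖)))) := by
          gcongr
          refine T.le_opNorm_of_le (((adjoint (A p.1)).le_of_opNorm_le (hA' _) _).trans ?_)
          gcongr
          exact (A p.1).le_of_opNorm_le (hA _) _
      _ = ‖T‖ * ‖x‖ := by ring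
  · have h1 : Tendsto (fun p : α × β => T (adjoint (A p.1) (A p.1 x))) (l ×ˢ l') (𝓝 (T x)) :=
      (T.continuous.tendsto x).comp ((hAlim x).comp tendsto_fst)
    have h2 : Tendsto (fun p : α × β => adjoint (B p.2) (B p.2 y)) (l ×ˢ l') (𝓝 y) :=
      (hBlim y).comp tendsto_snd
    refine (h2.inner h1).congr fun p => ?_
    simp [ContinuousLinearMap.adjoint_inner_left, ContinuousLinearMap.adjoint_inner_right]
  · calc opDist (adjoint (B p.2) ∘L (B p.2 ∘L T ∘L adjoint (A p.1)) ∘L A p.1) V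
        ≤ opDist (B p.2 ∘L T ∘L adjoint (A p.1)) U :=
          opDist_compression_le (hA _) (hB' _) (hUV p.1 p.2) _
      _ ≤ hyperreflexivityConstant U * reflexiveSeminorm U (B p.2 ∘L T ∘L adjoint (A p.1)) :=
          opDist_le_mul_reflexiveSeminorm hk _
      _ ≤ hyperreflexivityConstant U * reflexiveSeminorm V T := by
          gcongr
          exact reflexiveSeminorm_comp_comp_adjoint_le (hA _) (hB _) (hVU p.1 p.2) T

end Comparison

/-! ### Application to weak TRO equivalent spaces. -/

section TROEquivalence

open ContinuousLinearMap (adjoint)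

theorem eq_zero_of_erdosMap_top {H K : Type*}
    [NormedAddCommGroup H] [InnerProductSpace ℂ H]
    [NormedAddCommGroup K] [InnerProductSpace ℂ K] [CompleteSpace K]
    {S : Set (H →L[ℂ] K)} (hS : erdosMap S ⊤ = ⊤) {z : K}
    (hz : ∀ T ∈ S, ∀ x, ⟪z, T x⟫_ℂ = 0) : z = 0 := by
  have h := (Submodule.topologicalClosure_eq_top_iff).1 hS
  rw [← Submodule.mem_bot ℂ, ← h, Submodule.mem_orthogonal']
  intro u hu
  induction hu using Submodule.span_induction with
  | mem u hu =>
    obtain ⟨T, hT, x, -, rfl⟩ := hu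
    exact hz T hT x
  | zero => simp
  | add u v _ _ hu hv => rw [inner_add_right, hu, hv, add_zero]
  | smul c u _ hu => rw [inner_smul_right, hu, mul_zero]

variable {H₁ H₂ K₁ K₂ : Type*}
  [NormedAddCommGroup H₁] [InnerProductSpace ℂ H₁] [CompleteSpace H₁]
  [NormedAddCommGroup H₂] [InnerProductSpace ℂ H₂] [CompleteSpace H₂]
  [NormedAddCommGroup K₁] [InnerProductSpace ℂ K₁] [CompleteSpace K₁]
  [NormedAddCommGroup K₂] [InnerProductSpace ℂ K₂] [CompleteSpace K₂]
  {U : Submodule ℂ (K₁ →L[ℂ] K₂)} {V : Submodule ℂ (H₁ →L[ℂ] H₂)}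

theorem WeakTROEquivalent.symm (h : WeakTROEquivalent U V) : WeakTROEquivalent V U := by
  obtain ⟨M₁, M₂, hM₁, hM₂, hU, hV⟩ := h
  -- The adjoint spaces `M₁*` and `M₂*` are again TROs and exchange the two defining equations.
  let N₁ : Submodule ℂ (K₁ →L[ℂ] H₁) :=
    M₁.comap (adjoint (𝕜 := ℂ) (E := K₁) (F := H₁)).toLinearEquiv.toLinearMap
  let N₂ : Submodule ℂ (K₂ →L[ℂ] H₂) :=
    M₂.comap (adjoint (𝕜 := ℂ) (E := K₂) (F := H₂)).toLinearEquiv.toLinearMap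
  have h₁ : ∀ A, A ∈ N₁ ↔ adjoint A ∈ M₁ := fun _ => Iff.rfl
  have h₂ : ∀ A, A ∈ N₂ ↔ adjoint A ∈ M₂ := fun _ => Iff.rfl
  refine ⟨N₁, N₂, fun A hA B hB C hC => ?_, fun A hA B hB C hC => ?_, ?_, ?_⟩
  · rw [h₁, ContinuousLinearMap.adjoint_comp, ContinuousLinearMap.adjoint_comp]
    exact hM₁ _ hC _ hB _ hA
  · rw [h₂, ContinuousLinearMap.adjoint_comp, ContinuousLinearMap.adjoint_comp]
    exact hM₂ _ hC _ hB _ hA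
  · rw [hV]
    congr 1
    ext X
    constructor
    · rintro ⟨B, hB, T, hT, A, hA, rfl⟩
      exact ⟨adjoint B, by simpa [h₂], T, hT, adjoint A, by simpa [h₁], by simp⟩
    · rintro ⟨B, hB, T, hT, A, hA, rfl⟩
      exact ⟨adjoint B, hB, T, hT, adjoint A, hA, by simp⟩
  · rw [hU]
    congr 1
    ext X
    constructor
    · rintro ⟨B, hB, T, hT, A, hA, rfl⟩
      exact ⟨adjoint B, by simpa [h₂], T, hT, adjoint A, by simpa [h₁], by simp⟩
    · rintro ⟨B, hB, T, hT, A, hA, rfl⟩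
      exact ⟨adjoint B, hB, T, hT, adjoint A, hA, by simp⟩

/-- Weak TRO equivalence controls the hyperreflexivity constants of infinite amplifications. -/
theorem WeakTROEquivalent.hyperreflexivityConstant_matrixSpace_le
    (h : WeakTROEquivalent U V) (hU : IsWeakStarClosed U) (hV : IsWeakStarClosed V)
    (hVess : IsEssential V) (ι : Type*) [Infinite ι] :
    hyperreflexivityConstant (matrixSpace ι V) ≤ hyperreflexivityConstant (matrixSpace ι U) := by
  obtain ⟨M₁, M₂, hM₁, hM₂, hUeq, hVeq⟩ := h
  -- If `M₁` kills `x`, so does every `B* X A`, hence all of `V`; then `x` is orthogonal to the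
  -- ranges of `V*`, which are total.
  have hM₁0 : ∀ x, (∀ m ∈ M₁, m x = 0) → x = 0 := fun x hx => by
    refine eq_zero_of_erdosMap_top hVess.2 ?_
    rintro _ ⟨T, hT, rfl⟩ y
    rw [ContinuousLinearMap.adjoint_inner_right, ← inner_conj_symm]
    rw [inner_eq_zero_of_mem_weakStarSpan (y := y) ?_ (hVeq.subset hT), map_zero]
    rintro _ ⟨B, -, X, -, A, hA, rfl⟩
    simp [hx A hA]
  have hM₂0 : ∀ y, (∀ m ∈ M₂, m y = 0) → y = 0 := fun y hy => by
    refine eq_zero_of_erdosMap_top hVess.1 fun T hT x => ?_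
    refine inner_eq_zero_of_mem_weakStarSpan ?_ (hVeq.subset hT)
    rintro _ ⟨B, hB, X, -, A, -, rfl⟩
    simp [ContinuousLinearMap.adjoint_inner_right, hy B hB]
  have hUc := hU.isBoundedlyWeakClosed.isClosed
  have hVc := hV.isBoundedlyWeakClosed.isClosed
  -- The functional calculus yields columns over the norm closures of `M₁` and `M₂` only, so the
  -- inclusions are extended there by norm closedness of `U` and `V`.
  have hVU : ∀ b ∈ M₂.topologicalClosure, ∀ T ∈ V, ∀ a ∈ M₁.topologicalClosure,
      b ∘L T ∘L adjoint a ∈ U := fun b hb T hT a ha => by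
    rw [← SetLike.mem_coe, ← hUc.closure_eq]
    refine map_mem_closure₂ (f := fun (b : H₂ →L[ℂ] K₂) (a : H₁ →L[ℂ] K₁) => b ∘L T ∘L adjoint a)
      (by fun_prop) hb ha fun b hb a ha => ?_
    rw [hUeq]
    exact subset_weakStarSpan _ ⟨b, hb, T, hT, a, ha, rfl⟩
  have hUV : ∀ b ∈ M₂.topologicalClosure, ∀ X ∈ U, ∀ a ∈ M₁.topologicalClosure,
      adjoint b ∘L X ∘L a ∈ V := fun b hb X hX a ha => by
    rw [← SetLike.mem_coe, ← hVc.closure_eq]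
    refine map_mem_closure₂ (f := fun (b : H₂ →L[ℂ] K₂) (a : H₁ →L[ℂ] K₁) => adjoint b ∘L X ∘L a)
      (by fun_prop) hb ha fun b hb a ha => ?_
    rw [hVeq]
    exact subset_weakStarSpan _ ⟨b, hb, X, hX, a, ha, rfl⟩
  classical
  obtain ⟨A, hA, hAcol, hAlim⟩ := hM₁.exists_tendsto_columnOperator hM₁0 ι
  obtain ⟨B, hB, hBcol, hBlim⟩ := hM₂.exists_tendsto_columnOperator hM₂0 ι
  exact hyperreflexivityConstant_le_of_approx_compression
    (hV.isBoundedlyWeakClosed.matrixSpace ι) hA hB hAlim hBlim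
    (fun a b _ hX => (hAcol a).comp_comp_adjoint_mem (hBcol b) hVU hX)
    (fun a b _ hX => (hAcol a).adjoint_comp_comp_mem (hBcol b) hUV hX)

end TROEquivalence

end OperatorSpaces

theorem theorem3p6
    {H₁ H₂ K₁ K₂ : Type*}
    [NormedAddCommGroup H₁] [InnerProductSpace ℂ H₁] [CompleteSpace H₁]
    [NormedAddCommGroup H₂] [InnerProductSpace ℂ H₂] [CompleteSpace H₂]
    [NormedAddCommGroup K₁] [InnerProductSpace ℂ K₁] [CompleteSpace K₁]
    [NormedAddCommGroup K₂] [InnerProductSpace ℂ K₂] [CompleteSpace K₂]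
    (U : Submodule ℂ (K₁ →L[ℂ] K₂)) (V : Submodule ℂ (H₁ →L[ℂ] H₂))
    (hU : OperatorSpaces.IsWeakStarClosed U) (hV : OperatorSpaces.IsWeakStarClosed V)
    (hUess : OperatorSpaces.IsEssential U) (hVess : OperatorSpaces.IsEssential V)
    (hUV : OperatorSpaces.WeakTROEquivalent U V) :
    (∀ (ι κ₁ κ₂ : Type*) (_ : Infinite ι)
        (_ : HilbertBasis κ₁ ℂ H₁) (_ : HilbertBasis κ₂ ℂ H₂)
        (_ : Nonempty (κ₁ ↪ ι)) (_ : Nonempty (κ₂ ↪ ι)),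
      OperatorSpaces.hyperreflexivityConstant (OperatorSpaces.matrixSpace ι V) ≤
        OperatorSpaces.hyperreflexivityConstant (OperatorSpaces.matrixSpace ι U)) ∧
    (TopologicalSpace.SeparableSpace H₁ → TopologicalSpace.SeparableSpace H₂ →
      TopologicalSpace.SeparableSpace K₁ → TopologicalSpace.SeparableSpace K₂ →
      OperatorSpaces.hyperreflexivityConstant (OperatorSpaces.matrixSpace ℕ V) =
        OperatorSpaces.hyperreflexivityConstant (OperatorSpaces.matrixSpace ℕ U)) := by
  refine ⟨fun ι _ _ _ _ _ _ _ => ?_, fun _ _ _ _ => le_antisymm ?_ ?_⟩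
  · exact hUV.hyperreflexivityConstant_matrixSpace_le hU hV hVess ι
  · exact hUV.hyperreflexivityConstant_matrixSpace_le hU hV hVess ℕ
  · exact hUV.symm.hyperreflexivityConstant_matrixSpace_le hV hU hUess ℕ
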